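/- Let $\Gamma=(X,R)$ be a finite, simple, connected graph with path-length distance $\partial$ and diameter $d\ge 3$, and write $\Gamma_i(z)=\{w\in X:\partial(z,w)=i\}$. Assume that $\Gamma$ is distance-regular, i.e. for all $0\le h,i,j\le d$ the number $p^h_{ij}=|\Gamma_i(u)\cap\Gamma_j(v)|$ is the same for all $u,v\in X$ with $\partial(u,v)=h$. Put $k=p^0_{11}$ (the valency), $a_i=p^i_{1i}$, and assume $a_1\neq 0$. Let $A_i\in\mathrm{Mat}_X(\mathbb R)$ be the $i$-th distance matrix (entry $1$ at $(u,v)$ if $\partial(u,v)=i$, and $0$ otherwise), $A=A_1$, and let $M$ be the subalgebra of $\mathrm{Mat}_X(\mathbb R)$ generated by $A$. An eigenvalue of $\Gamma$ is a real $\theta$ with $AE=\theta E$ for some primitive idempotent $E$ of $M$; this $E$ is determined by $\theta$. Let $\theta\neq k$ be such an eigenvalue (a nontrivial eigenvalue), with primitive idempotent $E$, and let its cosine sequence $\sigma_0,\sigma_1,\dots,\sigma_d$ be the real numbers given by $$E=|X|^{-1}\,\mathrm{rank}(E)\sum_{i=0}^d\sigma_iA_i .$$ Write $\sigma=\sigma_1$.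 Let $x,y\in X$ be adjacent and put $D_i^j=\Gamma_i(x)\cap\Gamma_j(y)$. The edge $xy$ is called tight with respect to $\theta$ if the vectors $E\hat x$, $E\hat y$, $\sum_{z\in D_1^1}E\hat z$ are linearly dependent, where $\hat z\in\mathbb R^X$ is the standard basis vector at $z$. Then the following hold. (1) The edge $xy$ is tight with respect to $\theta$ if and only if for every $i$ with $1\le i\le d$ we have $\sigma_{i-1}\ne\sigma_i$ and, for all $z\in D_{i-1}^i$, $$|\Gamma_{i-1}(z)\cap D_1^1|=\frac{a_1}{1+\sigma}\,\frac{\sigma\sigma_{i-1}-\sigma_i}{\sigma_{i-1}-\sigma_i},\qquad |\Gamma_i(z)\cap D_1^1|=\frac{a_1}{1+\sigma}\,\frac{\sigma_{i-1}-\sigma\sigma_i}{\sigma_{i-1}-\sigma_i}.$$ (2) The edge $xy$ is tight with respect to $\theta$ if and only if for every $i$ with $1\le i\le d-1$ we have $\sigma_i\neq\sigma_{i+1}$ and, for all $z\in D_i^i$, $$|\Gamma_{i+1}(z)\cap D_1^1|=|\Gamma_{i-1}(z)\cap D_1^1|\,\frac{\sigma_{i-1}-\sigma_i}{\sigma_i-\sigma_{i+1}}+a_1\,\frac{1-\sigma}{1+\sigma}\,\frac{\sigma_i}{\sigma_i-\sigma_{i+1}},$$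 $$|\Gamma_i(z)\cap D_1^1|=-|\Gamma_{i-1}(z)\cap D_1^1|\,\frac{\sigma_{i-1}-\sigma_{i+1}}{\sigma_i-\sigma_{i+1}}+a_1\,\frac{2\sigma}{1+\sigma}-a_1\,\frac{1-\sigma}{1+\sigma}\,\frac{\sigma_{i+1}}{\sigma_i-\sigma_{i+1}}.$$ (3) If $xy$ is tight with respect to $\theta$ and $a_d\ne0$, then for all $z\in D_d^d$ $$|\Gamma_{d-1}(z)\cap D_1^1|=-a_1\,\frac{1-\sigma}{1+\sigma}\,\frac{\sigma_d}{\sigma_{d-1}-\sigma_d},\qquad |\Gamma_d(z)\cap D_1^1|=a_1+a_1\,\frac{1-\sigma}{1+\sigma}\,\frac{\sigma_d}{\sigma_{d-1}-\sigma_d}.$$ -/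

import Mathlib

namespace TightDRG

variable {V : Type*} [Fintype V] [DecidableEq V]

/-- The sphere `Γ_i(x)`: all vertices at path-length distance `i` from `x`. -/
noncomputable def sphere (G : SimpleGraph V) (i : ℕ) (x : V) : Finset V :=
  Finset.univ.filter fun y => G.dist x y = i

/-- A finite simple graph is distance-regular if it is connected and, for all
`0 ≤ h, i, j ≤ d` (with `d` the diameter) and all vertices `x`, `y` at distance `h`, the number
`|Γ_i(x) ∩ Γ_j(y)|` does not depend on the choice of `x` and `y`. -/
def IsDistanceRegular (G : SimpleGraph V) : Prop :=
  G.Connected ∧ ∀ h i j : ℕ, h ≤ G.diam → i ≤ G.diam → j ≤ G.diam →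
    ∀ x y x' y' : V, G.dist x y = h → G.dist x' y' = h →
      (sphere G i x ∩ sphere G j y).card = (sphere G i x' ∩ sphere G j y').card

open Classical in
/-- The intersection number `p^h_{ij} = |Γ_i(x) ∩ Γ_j(y)|`, evaluated at some pair `(x, y)` of
vertices at distance `h` (and `0` if there is no such pair). -/
noncomputable def intersectionNumber (G : SimpleGraph V) (h i j : ℕ) : ℕ :=
  if hq : ∃ q : V × V, G.dist q.1 q.2 = h then
    (sphere G i hq.choose.1 ∩ sphere G j hq.choose.2).card
  else 0

/-- In a distance-regular graph every pair at distance `h` computes `p^h_{ij}`. -/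
theorem IsDistanceRegular.card_inter_eq {G : SimpleGraph V} (hG : IsDistanceRegular G)
    {h i j : ℕ} (hh : h ≤ G.diam) (hi : i ≤ G.diam) (hj : j ≤ G.diam) {x y : V}
    (hxy : G.dist x y = h) :
    (sphere G i x ∩ sphere G j y).card = intersectionNumber G h i j := by
  have hq : ∃ q : V × V, G.dist q.1 q.2 = h := ⟨(x, y), hxy⟩
  rw [intersectionNumber, dif_pos hq]
  exact hG.2 h i j hh hi hj _ _ _ _ hxy hq.choose_spec

/-- The valency `k = p^0_{11}`. -/
noncomputable def valency (G : SimpleGraph V) : ℕ := intersectionNumber G 0 1 1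

/-- The intersection number `a_i = p^i_{1i}`. -/
noncomputable def intersectionA (G : SimpleGraph V) (i : ℕ) : ℕ := intersectionNumber G i 1 i

/-- The `i`-th distance matrix `A_i`; `A_1` is the adjacency matrix. -/
noncomputable def distMatrix (G : SimpleGraph V) (i : ℕ) : Matrix V V ℝ :=
  Matrix.of fun x y => if G.dist x y = i then 1 else 0

/-- The Bose-Mesner algebra: the subalgebra of `Mat_V(ℝ)` generated by the adjacency matrix. -/
noncomputable def boseMesner (G : SimpleGraph V) : Subalgebra ℝ (Matrix V V ℝ) :=
  Algebra.adjoin ℝ {distMatrix G 1}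

/-- `E` is a primitive idempotent of the Bose-Mesner algebra `M`: a nonzero idempotent of `M`
such that the only idempotents `F` of `M` with `E F = F` are `0` and `E`. -/
def IsPrimitiveIdempotent (G : SimpleGraph V) (E : Matrix V V ℝ) : Prop :=
  E ∈ boseMesner G ∧ E ≠ 0 ∧ E * E = E ∧
    ∀ F ∈ boseMesner G, F * F = F → E * F = F → F = 0 ∨ F = E

/-- `E` is the primitive idempotent associated with `θ`: it is primitive and `A E = θ E`. -/
def IsIdempotentOf (G : SimpleGraph V) (θ : ℝ) (E : Matrix V V ℝ) : Prop :=
  IsPrimitiveIdempotent G E ∧ distMatrix G 1 * E = θ • E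

/-- `θ` is an eigenvalue of the graph: it is associated with some primitive idempotent. -/
def IsEigenvalue (G : SimpleGraph V) (θ : ℝ) : Prop :=
  ∃ E : Matrix V V ℝ, IsIdempotentOf G θ E

/-- A nontrivial eigenvalue is one different from the trivial eigenvalue `k`. -/
def IsNontrivialEigenvalue (G : SimpleGraph V) (θ : ℝ) : Prop :=
  IsEigenvalue G θ ∧ θ ≠ (valency G : ℝ)

/-- `σ_0, …, σ_d` is the cosine sequence of `θ`:
`E = |V|⁻¹ m ∑_{i=0}^d σ_i A_i`, where `E` is the primitive idempotent associated with `θ` and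
`m = rank E`. Only the values `σ i` with `i ≤ d` matter. -/
def IsCosineSequence (G : SimpleGraph V) (θ : ℝ) (σ : ℕ → ℝ) : Prop :=
  ∃ E : Matrix V V ℝ, IsIdempotentOf G θ E ∧
    E = ((Fintype.card V : ℝ)⁻¹ * (E.rank : ℝ)) •
      ∑ i ∈ Finset.range (G.diam + 1), σ i • distMatrix G i

/-- The cell `D_i^j(x, y) = Γ_i(x) ∩ Γ_j(y)`. -/
noncomputable def cell (G : SimpleGraph V) (x y : V) (i j : ℕ) : Finset V :=
  sphere G i x ∩ sphere G j y

/-- The pair `x`, `y` is tight with respect to `θ`: the vectors `E x̂`, `E ŷ` and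
`∑_{z ∈ D_1^1(x, y)} E ẑ` are linearly dependent, where `E` is the primitive idempotent associated
with `θ` and `x̂`, `ŷ`, `ẑ` are the standard basis vectors. -/
def IsTightEdge (G : SimpleGraph V) (θ : ℝ) (x y : V) : Prop :=
  ∃ E : Matrix V V ℝ, IsIdempotentOf G θ E ∧
    ¬ LinearIndependent ℝ
      ![E.mulVec (Pi.single x 1), E.mulVec (Pi.single y 1),
        ∑ z ∈ cell G x y 1 1, E.mulVec (Pi.single z 1)]

end TightDRG

set_option linter.unusedSectionVars false

namespace TightDRG

variable {V : Type*} [Fintype V] [DecidableEq V] {G : SimpleGraph V}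

/-! Put `c = a₁σ/(1+σ)` and `g = ∑_{w ∈ D_1^1} ŵ - c(x̂ + ŷ)`. The constant `c` makes `E g`
orthogonal to `E x̂` and `E ŷ`, so tightness means `E g = 0` (`isTightEdge_iff`). Up to a nonzero
factor, the coordinate of `E g` at `z` is `defect`, a combination of cosines weighted by the numbers
of vertices of `D_1^1` at each distance from `z`. If it vanishes, this equation and the total count
`a₁` are two linear equations that determine the stated counts.

For the converses, `‖E g‖² = ⟨g, E g⟩` is a multiple of the defect summed over `D_1^1`, so one zero
sum forces `E g = 0` (`defect_eq_zero_of_sum`). In (2) the case `i = 1` gives zero termwise. In (1)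
the case `i = 2` gives zero on `D_1^2`, and the eigenvector equation at `x` carries this to the sum
over `D_1^1`. -/

theorem mem_sphere {i : ℕ} {x z : V} : z ∈ sphere G i x ↔ G.dist x z = i := by
  simp [sphere]

theorem mem_cell {i j : ℕ} {x y z : V} :
    z ∈ cell G x y i j ↔ G.dist x z = i ∧ G.dist y z = j := by
  simp [cell, mem_sphere]

theorem dist_le_diam_of_connected (hG : G.Connected) (x y : V) : G.dist x y ≤ G.diam := by
  have := hG.nonempty
  exact SimpleGraph.dist_le_diam (SimpleGraph.connected_iff_ediam_ne_top.mp hG)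

/-! ### The Bose-Mesner algebra -/

/-- The generator is symmetric and the algebra is commutative, so products stay symmetric. -/
theorem transpose_of_mem_boseMesner {B : Matrix V V ℝ} (hB : B ∈ boseMesner G) :
    B.transpose = B := by
  have hA : (distMatrix G 1).transpose = distMatrix G 1 := by
    ext u v; rw [Matrix.transpose_apply, distMatrix, Matrix.of_apply, Matrix.of_apply,
      SimpleGraph.dist_comm]
  induction hB using Algebra.adjoin_induction with
  | mem x hx => rw [Set.mem_singleton_iff] at hx; rw [hx, hA]
  | algebraMap r => simp [Algebra.algebraMap_eq_smul_one]
  | add x y _ _ hx hy => rw [Matrix.transpose_add, hx, hy]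
  | mul x y hx' hy' hx hy =>
    rw [Matrix.transpose_mul, hx, hy]
    have hc : ∀ b ∈ boseMesner G, Commute (distMatrix G 1) b := fun b hb =>
      Algebra.commute_of_mem_adjoin_self hb
    exact (Algebra.commute_of_mem_adjoin_singleton_of_commute hx' (hc y hy').symm).eq

theorem exists_mul_eq_smul_of_mem_boseMesner {θ : ℝ} {E F B : Matrix V V ℝ}
    (hE : distMatrix G 1 * E = θ • E) (hF : distMatrix G 1 * F = θ • F)
    (hB : B ∈ boseMesner G) : ∃ t : ℝ, B * E = t • E ∧ B * F = t • F := by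
  induction hB using Algebra.adjoin_induction with
  | mem x hx => rw [Set.mem_singleton_iff] at hx; subst hx; exact ⟨θ, hE, hF⟩
  | algebraMap r => exact ⟨r, by simp [Algebra.algebraMap_eq_smul_one]⟩
  | add x y _ _ hx hy =>
    obtain ⟨s, h1, h2⟩ := hx
    obtain ⟨t, h3, h4⟩ := hy
    exact ⟨s + t, by rw [add_mul, h1, h3, add_smul], by rw [add_mul, h2, h4, add_smul]⟩
  | mul x y _ _ hx hy =>
    obtain ⟨s, h1, h2⟩ := hx
    obtain ⟨t, h3, h4⟩ := hy
    exact ⟨t * s, by rw [mul_assoc, h3, mul_smul_comm, h1, smul_smul],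
      by rw [mul_assoc, h4, mul_smul_comm, h2, smul_smul]⟩

/-- Every polynomial in `A` acts on `E` and on `F` by one common scalar; for `E` itself that scalar
is 1, because `E * E = E ≠ 0`. -/
theorem IsIdempotentOf.mul_eq {θ : ℝ} {E F : Matrix V V ℝ}
    (hE : IsIdempotentOf G θ E) (hF : IsIdempotentOf G θ F) : E * F = F := by
  obtain ⟨t, h1, h2⟩ := exists_mul_eq_smul_of_mem_boseMesner hE.2 hF.2 hE.1.1
  have ht : t = 1 := by
    rw [hE.1.2.2.1] at h1
    have : (1 - t) • E = 0 := by rw [sub_smul, one_smul, ← h1, sub_self]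
    rcases smul_eq_zero.mp this with h | h
    · linarith
    · exact absurd h hE.1.2.1
  rw [h2, ht, one_smul]

/-- The primitive idempotent associated with `θ` is unique. -/
theorem IsIdempotentOf.unique {θ : ℝ} {E F : Matrix V V ℝ}
    (hE : IsIdempotentOf G θ E) (hF : IsIdempotentOf G θ F) : E = F := by
  have h1 := congrArg Matrix.transpose (hE.mul_eq hF)
  rw [Matrix.transpose_mul, transpose_of_mem_boseMesner hE.1.1,
    transpose_of_mem_boseMesner hF.1.1, hF.mul_eq hE] at h1
  exact h1

theorem trace_eq_rank_of_idempotent {E : Matrix V V ℝ} (hE : E * E = E) :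
    E.trace = (E.rank : ℝ) := by
  have hid : IsIdempotentElem (Matrix.toLin' E) := by
    rw [IsIdempotentElem, Module.End.mul_eq_comp, ← Matrix.toLin'_mul, hE]
  have h := (LinearMap.IsIdempotentElem.isProj_range _ hid).trace
  rw [Matrix.trace_toLin'_eq] at h
  exact h

/-! ### Cosine sequences -/

/-- The entries of the idempotent are `κ σ_{∂(u,v)}` for a nonzero constant `κ`, and `σ_0 = 1`. -/
theorem exists_entries_eq (hG : G.Connected) {θ : ℝ} {σ : ℕ → ℝ} {E : Matrix V V ℝ}
    (hE : IsIdempotentOf G θ E)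
    (hσ : E = ((Fintype.card V : ℝ)⁻¹ * (E.rank : ℝ)) •
      ∑ i ∈ Finset.range (G.diam + 1), σ i • distMatrix G i) :
    ∃ κ : ℝ, κ ≠ 0 ∧ σ 0 = 1 ∧ ∀ u v, E u v = κ * σ (G.dist u v) := by
  have := hG.nonempty
  have hent : ∀ u v, E u v = ((Fintype.card V : ℝ)⁻¹ * (E.rank : ℝ)) * σ (G.dist u v) := by
    intro u v
    have h := congrFun (congrFun hσ u) v
    rw [Matrix.smul_apply, Matrix.sum_apply, smul_eq_mul] at h
    rw [h]
    congr 1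
    simp only [Matrix.smul_apply, distMatrix, Matrix.of_apply, smul_eq_mul, mul_ite, mul_one,
      mul_zero]
    rw [Finset.sum_ite_eq, if_pos]
    exact Finset.mem_range_succ_iff.mpr (dist_le_diam_of_connected hG u v)
  have hκ : ((Fintype.card V : ℝ)⁻¹ * (E.rank : ℝ)) ≠ 0 := by
    intro h0
    apply hE.1.2.1
    ext u v
    rw [hent, h0]; simp
  refine ⟨_, hκ, ?_, hent⟩
  -- Computing the trace as the rank and as the sum of the diagonal entries gives `σ 0 = 1`.
  have htr : E.trace = (E.rank : ℝ) := trace_eq_rank_of_idempotent hE.1.2.2.1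
  have hr : (E.rank : ℝ) ≠ 0 := right_ne_zero_of_mul hκ
  have hc : (Fintype.card V : ℝ) ≠ 0 := by simp
  have h2 : E.trace = (E.rank : ℝ) * σ 0 := by
    simp only [Matrix.trace, Matrix.diag, hent, SimpleGraph.dist_self, Finset.sum_const,
      Finset.card_univ, nsmul_eq_mul]
    field_simp
  exact mul_left_cancel₀ hr (by rw [← h2, htr, mul_one])

theorem sum_sphere_one {θ κ : ℝ} {σ : ℕ → ℝ} {E : Matrix V V ℝ}
    (hE : distMatrix G 1 * E = θ • E) (hκ : κ ≠ 0)
    (hent : ∀ u v, E u v = κ * σ (G.dist u v)) (u v : V) :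
    ∑ w ∈ sphere G 1 u, σ (G.dist w v) = θ * σ (G.dist u v) := by
  have h := congrFun (congrFun hE u) v
  simp only [Matrix.mul_apply, distMatrix, Matrix.of_apply, Matrix.smul_apply, smul_eq_mul, hent,
    ite_mul, one_mul, zero_mul] at h
  rw [← Finset.sum_filter, ← Finset.mul_sum] at h
  apply mul_left_cancel₀ hκ
  rw [sphere, h]; ring

/-- For `E` symmetric and idempotent, the squared norm of `E g` is `⟨g, E g⟩`. -/
theorem eq_zero_of_dotProduct_mulVec {E : Matrix V V ℝ} (hs : E.transpose = E) (hE : E * E = E)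
    {g : V → ℝ} (h : g ⬝ᵥ E.mulVec g = 0) : E.mulVec g = 0 := by
  apply dotProduct_self_eq_zero.mp
  rw [← h, Matrix.dotProduct_mulVec, ← Matrix.mulVec_transpose, hs, Matrix.mulVec_mulVec, hE,
    dotProduct_comm]

/-- If `σ 1 = -1`, then `E û = -E v̂` on every edge. Three sign changes around a triangle force `E
x̂ = 0`, against the diagonal entry `κ`. -/
theorem cosine_one_ne_neg_one {κ : ℝ} {σ : ℕ → ℝ} {E : Matrix V V ℝ}
    (hs : E.transpose = E) (hE : E * E = E) (hκ : κ ≠ 0) (h0 : σ 0 = 1)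
    (hent : ∀ u v, E u v = κ * σ (G.dist u v)) {x y z : V}
    (hxy : G.dist x y = 1) (hxz : G.dist x z = 1) (hyz : G.dist y z = 1) : σ 1 ≠ -1 := by
  intro h1
  have key : ∀ u v, G.dist u v = 1 → ∀ t, E t u = - E t v := by
    intro u v huv t
    have h := eq_zero_of_dotProduct_mulVec hs hE (g := Pi.single u 1 + Pi.single v 1) (by
      simp only [Matrix.mulVec_add, Matrix.mulVec_single_one, add_dotProduct, dotProduct_add,
        single_dotProduct, Matrix.col_apply, hent, SimpleGraph.dist_self, huv, h0, h1,
        SimpleGraph.dist_comm (u := v) (v := u)]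
      ring)
    have h2 := congrFun h t
    simp only [Matrix.mulVec_add, Matrix.mulVec_single_one, Pi.add_apply, Matrix.col_apply,
      Pi.zero_apply] at h2
    linarith
  have e1 := key x y hxy x
  have e2 := key x z hxz x
  have e3 := key y z hyz x
  have e4 := hent x x
  rw [SimpleGraph.dist_self, h0, mul_one] at e4
  apply hκ; linarith

/-- Every distance up to the diameter is attained. -/
theorem exists_adj_dist_succ (hG : G.Connected) {i : ℕ} (hi : i + 1 ≤ G.diam) :
    ∃ u w v, G.dist u w = 1 ∧ G.dist u v = i + 1 ∧ G.dist w v = i := by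
  have := hG.nonempty
  obtain ⟨a, v, hav⟩ := G.exists_dist_eq_diam
  obtain ⟨p, hp⟩ := hG.exists_walk_length_eq_dist a v
  -- Drop edges from the front of a geodesic until `i + 1` remain.
  have hsplit : ∀ {a v : V} (p : G.Walk a v), p.length = G.dist a v → i + 1 ≤ p.length →
      ∃ u w, G.dist u w = 1 ∧ G.dist u v = i + 1 ∧ G.dist w v = i := by
    intro a v p
    induction p with
    | nil => intro _ h; simp at h
    | @cons a b v hab p ih =>
      intro hp hl
      rw [SimpleGraph.Walk.length_cons] at hp hl
      have hab1 : G.dist a b = 1 := SimpleGraph.dist_eq_one_iff_adj.mpr hab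
      have h1 := hG.dist_triangle (u := a) (v := b) (w := v)
      have h2 := SimpleGraph.dist_le p
      rcases Nat.lt_or_ge p.length (i + 1) with h | h
      · exact ⟨a, b, hab1, by omega, by omega⟩
      · exact ih (by omega) h
  obtain ⟨u, w, h⟩ := hsplit p hp (by omega)
  exact ⟨u, w, v, h⟩

/-- Two consecutive cosines do not both vanish. -/
theorem not_consecutive_zero (hG : G.Connected) {θ : ℝ} {σ : ℕ → ℝ} (h0 : σ 0 = 1)
    (hrec : ∀ u v, ∑ w ∈ sphere G 1 u, σ (G.dist w v) = θ * σ (G.dist u v)) (i : ℕ)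
    (hi : i + 1 ≤ G.diam) (h1 : σ i = 0) (h2 : σ (i + 1) = 0) : False := by
  induction i with
  | zero => rw [h0] at h1; exact one_ne_zero h1
  | succ i ih =>
    refine ih (by omega) ?_ h1
    obtain ⟨u, w, v, huw, huv, hwv⟩ := exists_adj_dist_succ hG (i := i) (by omega)
    have h := hrec u v
    rw [huv, h1, mul_zero] at h
    -- Of the three possible distances from `t` to `v`, only `i` can carry a nonzero cosine; `w`
    -- shows that it occurs, so `σ i = 0`.
    have h3 : ∀ t ∈ sphere G 1 u,
        σ (G.dist t v) = if G.dist t v = i then σ i else 0 := by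
      intro t ht
      rw [mem_sphere] at ht
      have e1 := hG.dist_triangle (u := t) (v := u) (w := v)
      have e2 := hG.dist_triangle (u := u) (v := t) (w := v)
      rw [SimpleGraph.dist_comm (u := t) (v := u)] at e1
      split_ifs with hc
      · rw [hc]
      · have : G.dist t v = i + 1 ∨ G.dist t v = i + 1 + 1 := by omega
        rcases this with h | h <;> rw [h] <;> assumption
    rw [Finset.sum_congr rfl h3, ← Finset.sum_filter, Finset.sum_const, nsmul_eq_mul] at h
    rcases mul_eq_zero.mp h with h | h
    · exfalso
      rw [Nat.cast_eq_zero, Finset.card_eq_zero] at h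
      have : w ∈ (sphere G 1 u).filter fun t => G.dist t v = i := by
        simp [mem_sphere, huw, hwv]
      rw [h] at this; simp at this
    · exact h

/-- A sum of a function of the distance from `z`, grouped by distance. -/
theorem sum_dist_eq {T : Finset ℕ} {s : Finset V} {z : V} (f : ℕ → ℝ)
    (hT : ∀ w ∈ s, G.dist z w ∈ T) :
    ∑ w ∈ s, f (G.dist z w) = ∑ i ∈ T, ((sphere G i z ∩ s).card : ℝ) * f i := by
  rw [← Finset.sum_fiberwise_of_maps_to hT]
  refine Finset.sum_congr rfl fun i _ => ?_
  have : sphere G i z ∩ s = s.filter fun w => G.dist z w = i := by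
    ext w; simp [mem_sphere, and_comm]
  rw [this, ← nsmul_eq_mul, ← Finset.sum_const]
  exact Finset.sum_congr rfl fun w hw => by rw [(Finset.mem_filter.mp hw).2]

/-! ### The defect and its relation to tightness -/

/-- `⟨E ẑ, ∑_{w ∈ D_1^1} E ŵ - c (E x̂ + E ŷ)⟩` up to the normalising constant. -/
noncomputable def defect (G : SimpleGraph V) (σ : ℕ → ℝ) (c : ℝ) (x y z : V) : ℝ :=
  ∑ w ∈ cell G x y 1 1, σ (G.dist z w) - c * (σ (G.dist z x) + σ (G.dist z y))

/-- The coefficient vector `∑_{w ∈ D_1^1} ŵ - c (x̂ + ŷ)`. -/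
noncomputable def defectVec (G : SimpleGraph V) (c : ℝ) (x y : V) : V → ℝ :=
  ∑ w ∈ cell G x y 1 1, Pi.single w 1 - c • (Pi.single x 1 + Pi.single y 1)

theorem mulVec_defectVec {κ c : ℝ} {σ : ℕ → ℝ} {E : Matrix V V ℝ}
    (hent : ∀ u v, E u v = κ * σ (G.dist u v)) (x y z : V) :
    E.mulVec (defectVec G c x y) z = κ * defect G σ c x y z := by
  simp only [defectVec, defect, Matrix.mulVec_sub, Matrix.mulVec_sum, Matrix.mulVec_smul,
    Matrix.mulVec_add, Matrix.mulVec_single_one, Pi.sub_apply, Finset.sum_apply, Pi.smul_apply,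
    Pi.add_apply, Matrix.col_apply, hent, smul_eq_mul, mul_sub, Finset.mul_sum]
  ring

theorem defectVec_dotProduct (c : ℝ) (x y : V) (f : V → ℝ) :
    defectVec G c x y ⬝ᵥ f = ∑ w ∈ cell G x y 1 1, f w - c * (f x + f y) := by
  simp only [defectVec, sub_dotProduct, sum_dotProduct, smul_dotProduct, add_dotProduct,
    single_dotProduct, smul_eq_mul, one_mul]

theorem sum_cell_one_one_left {σ : ℕ → ℝ} {x y : V} :
    ∑ w ∈ cell G x y 1 1, σ (G.dist x w) = ((cell G x y 1 1).card : ℝ) * σ 1 := by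
  rw [Finset.sum_congr rfl fun w hw => by rw [(mem_cell.mp hw).1], Finset.sum_const, nsmul_eq_mul]

theorem sum_cell_one_one_right {σ : ℕ → ℝ} {x y : V} :
    ∑ w ∈ cell G x y 1 1, σ (G.dist y w) = ((cell G x y 1 1).card : ℝ) * σ 1 := by
  rw [Finset.sum_congr rfl fun w hw => by rw [(mem_cell.mp hw).2], Finset.sum_const, nsmul_eq_mul]

/-- This equation fixes the constant: it reads `a₁σ = c(1 + σ)`. -/
theorem defect_left {σ : ℕ → ℝ} {x y : V} (h0 : σ 0 = 1) (hn : σ 1 ≠ -1) (hxy : G.dist x y = 1) :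
    defect G σ ((cell G x y 1 1).card * σ 1 / (1 + σ 1)) x y x = 0 := by
  have : 1 + σ 1 ≠ 0 := fun h => hn (by linarith)
  rw [defect, sum_cell_one_one_left, SimpleGraph.dist_self, hxy, h0]
  field_simp; ring

theorem defect_right {σ : ℕ → ℝ} {x y : V} (h0 : σ 0 = 1) (hn : σ 1 ≠ -1)
    (hxy : G.dist x y = 1) :
    defect G σ ((cell G x y 1 1).card * σ 1 / (1 + σ 1)) x y y = 0 := by
  have : 1 + σ 1 ≠ 0 := fun h => hn (by linarith)
  rw [defect, sum_cell_one_one_right, SimpleGraph.dist_self, SimpleGraph.dist_comm, hxy, h0]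
  field_simp; ring

/-- The defect vanishes identically as soon as it sums to zero over `D_1^1`. -/
theorem defect_eq_zero_of_sum {κ : ℝ} {σ : ℕ → ℝ} {E : Matrix V V ℝ}
    (hs : E.transpose = E) (hE : E * E = E) (hκ : κ ≠ 0) (h0 : σ 0 = 1) (hn : σ 1 ≠ -1)
    (hent : ∀ u v, E u v = κ * σ (G.dist u v)) {x y : V} (hxy : G.dist x y = 1)
    (h : ∑ w ∈ cell G x y 1 1,
      defect G σ ((cell G x y 1 1).card * σ 1 / (1 + σ 1)) x y w = 0) (z : V) :
    defect G σ ((cell G x y 1 1).card * σ 1 / (1 + σ 1)) x y z = 0 := by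
  have hz := eq_zero_of_dotProduct_mulVec hs hE
    (g := defectVec G ((cell G x y 1 1).card * σ 1 / (1 + σ 1)) x y) (by
      rw [defectVec_dotProduct]
      simp only [mulVec_defectVec hent]
      rw [← Finset.mul_sum, h, defect_left h0 hn hxy, defect_right h0 hn hxy]
      ring)
  have := congrFun hz z
  rw [mulVec_defectVec hent] at this
  exact (mul_eq_zero.mp this).resolve_left hκ

/-- An edge is tight exactly when its defect vanishes identically. -/
theorem isTightEdge_iff {θ κ : ℝ} {σ : ℕ → ℝ} {E : Matrix V V ℝ}
    (hid : IsIdempotentOf G θ E) (hκ : κ ≠ 0) (h0 : σ 0 = 1) (hn : σ 1 ≠ -1) (h1 : σ 1 ≠ 1)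
    (hent : ∀ u v, E u v = κ * σ (G.dist u v)) {x y : V} (hxy : G.dist x y = 1) :
    IsTightEdge G θ x y ↔
      ∀ z, defect G σ ((cell G x y 1 1).card * σ 1 / (1 + σ 1)) x y z = 0 := by
  have hn' : 1 + σ 1 ≠ 0 := fun h => hn (by linarith)
  have h1' : 1 - σ 1 ≠ 0 := fun h => h1 (by linarith)
  have hcomb : ∀ (r : Fin 3 → ℝ) (z : V),
      (∑ i, r i • (![E.mulVec (Pi.single x 1), E.mulVec (Pi.single y 1),
        ∑ z ∈ cell G x y 1 1, E.mulVec (Pi.single z 1)] : Fin 3 → V → ℝ) i) z =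
      κ * (r 0 * σ (G.dist z x) + r 1 * σ (G.dist z y) +
        r 2 * ∑ w ∈ cell G x y 1 1, σ (G.dist z w)) := by
    intro r z
    simp [Fin.sum_univ_three, hent, ← Finset.mul_sum]
    ring
  constructor
  · rintro ⟨F, hF, hlin⟩ z
    obtain rfl := hid.unique hF
    obtain ⟨r, hr, hne⟩ := Fintype.not_linearIndependent_iff.mp hlin
    have hr' : ∀ z, r 0 * σ (G.dist z x) + r 1 * σ (G.dist z y) +
        r 2 * ∑ w ∈ cell G x y 1 1, σ (G.dist z w) = 0 := by
      intro z
      have := congrFun hr z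
      rw [hcomb] at this
      exact (mul_eq_zero.mp this).resolve_left hκ
    have ex := hr' x
    have ey := hr' y
    rw [sum_cell_one_one_left, SimpleGraph.dist_self, hxy, h0] at ex
    rw [sum_cell_one_one_right, SimpleGraph.dist_self, SimpleGraph.dist_comm, hxy, h0] at ey
    -- Evaluating at `x` and `y` forces any dependency to be a multiple of `(-c, -c, 1)`.
    have e01 : r 0 = r 1 := by
      have : (r 0 - r 1) * (1 - σ 1) = 0 := by linarith
      linarith [(mul_eq_zero.mp this).resolve_right h1']
    have e2 : r 0 = - r 2 * ((cell G x y 1 1).card * σ 1 / (1 + σ 1)) := by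
      field_simp
      rw [← e01] at ex
      linarith
    have hr2 : r 2 ≠ 0 := by
      intro h
      obtain ⟨i, hi⟩ := hne
      rw [h] at e2
      fin_cases i
      · exact hi (by simpa using e2)
      · exact hi (by rw [e01] at e2; simpa using e2)
      · exact hi h
    have ez := hr' z
    rw [← e01, e2] at ez
    apply mul_left_cancel₀ hr2
    rw [defect]
    linarith
  · intro h
    refine ⟨E, hid, Fintype.not_linearIndependent_iff.mpr
      ⟨![-((cell G x y 1 1).card * σ 1 / (1 + σ 1)),
        -((cell G x y 1 1).card * σ 1 / (1 + σ 1)), 1], ?_, 2, by simp⟩⟩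
    ext z
    rw [hcomb]
    have := h z
    rw [defect] at this
    simp only [Matrix.cons_val, Pi.zero_apply]
    apply mul_eq_zero_of_right
    linarith

/-! ### Counting `D_1^1` by distance from a vertex -/

theorem dist_mem_of_mem_cell_one_one (hG : G.Connected) {x y z w : V} {i j : ℕ}
    (hz : z ∈ cell G x y i j) (hw : w ∈ cell G x y 1 1) :
    (G.dist z w ≤ i + 1 ∧ i ≤ G.dist z w + 1) ∧ (G.dist z w ≤ j + 1 ∧ j ≤ G.dist z w + 1) := by
  rw [mem_cell] at hz hw
  have e1 := hG.dist_triangle (u := z) (v := x) (w := w)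
  have e2 := hG.dist_triangle (u := x) (v := w) (w := z)
  have e3 := hG.dist_triangle (u := z) (v := y) (w := w)
  have e4 := hG.dist_triangle (u := y) (v := w) (w := z)
  rw [SimpleGraph.dist_comm (u := z) (v := x)] at e1
  rw [SimpleGraph.dist_comm (u := z) (v := y)] at e3
  rw [SimpleGraph.dist_comm (u := w) (v := z)] at e2 e4
  omega

/-- The counts at `z` of vertices in a set all of whose distances to `z` are `p` or `q`. -/
theorem sum_dist_pair {p q : ℕ} (hpq : p ≠ q) {s : Finset V} {z : V}
    (h : ∀ w ∈ s, G.dist z w = p ∨ G.dist z w = q) (f : ℕ → ℝ) :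
    ∑ w ∈ s, f (G.dist z w) =
      ((sphere G p z ∩ s).card : ℝ) * f p + ((sphere G q z ∩ s).card : ℝ) * f q := by
  rw [sum_dist_eq (T := {p, q}) f (by simpa using h), Finset.sum_pair hpq]

theorem card_dist_pair {p q : ℕ} (hpq : p ≠ q) {s : Finset V} {z : V}
    (h : ∀ w ∈ s, G.dist z w = p ∨ G.dist z w = q) :
    (s.card : ℝ) = (sphere G p z ∩ s).card + (sphere G q z ∩ s).card := by
  simpa using sum_dist_pair hpq h fun _ => 1

theorem sum_dist_triple {i : ℕ} {s : Finset V} {z : V}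
    (h : ∀ w ∈ s, G.dist z w = i ∨ G.dist z w = i + 1 ∨ G.dist z w = i + 2) (f : ℕ → ℝ) :
    ∑ w ∈ s, f (G.dist z w) =
      ((sphere G i z ∩ s).card : ℝ) * f i + ((sphere G (i + 1) z ∩ s).card : ℝ) * f (i + 1) +
        ((sphere G (i + 2) z ∩ s).card : ℝ) * f (i + 2) := by
  rw [sum_dist_eq (T := {i, i + 1, i + 2}) f (by simpa using h),
    Finset.sum_insert (by simp), Finset.sum_pair (by simp), add_assoc]

theorem card_dist_triple {i : ℕ} {s : Finset V} {z : V}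
    (h : ∀ w ∈ s, G.dist z w = i ∨ G.dist z w = i + 1 ∨ G.dist z w = i + 2) :
    (s.card : ℝ) = (sphere G i z ∩ s).card + (sphere G (i + 1) z ∩ s).card +
      (sphere G (i + 2) z ∩ s).card := by
  simpa using sum_dist_triple h fun _ => 1

theorem dist_cell_pair (hG : G.Connected) {x y z : V} {i : ℕ} (hz : z ∈ cell G x y i (i + 1)) :
    ∀ w ∈ cell G x y 1 1, G.dist z w = i ∨ G.dist z w = i + 1 := by
  intro w hw
  have := dist_mem_of_mem_cell_one_one hG hz hw
  omega

theorem dist_cell_triple (hG : G.Connected) {x y z : V} {i : ℕ}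
    (hz : z ∈ cell G x y (i + 1) (i + 1)) :
    ∀ w ∈ cell G x y 1 1, G.dist z w = i ∨ G.dist z w = i + 1 ∨ G.dist z w = i + 2 := by
  intro w hw
  have := dist_mem_of_mem_cell_one_one hG hz hw
  omega

/-! ### Eigenvector equation for the defect; distinct consecutive cosines -/

/-- Summing the defect over the neighbours of a vertex multiplies it by the eigenvalue. -/
theorem sum_sphere_one_defect {θ : ℝ} {σ : ℕ → ℝ}
    (hrec : ∀ u v, ∑ w ∈ sphere G 1 u, σ (G.dist w v) = θ * σ (G.dist u v)) (c : ℝ)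
    (x y u : V) : ∑ z ∈ sphere G 1 u, defect G σ c x y z = θ * defect G σ c x y u := by
  simp only [defect, Finset.sum_sub_distrib, ← Finset.mul_sum, Finset.sum_add_distrib, hrec]
  rw [Finset.sum_comm]
  simp only [hrec, ← Finset.mul_sum]
  ring

/-- If the defect vanishes at `x`, `y` and on `D_1^2`, it sums to zero over `D_1^1`. -/
theorem sum_defect_eq_zero_of_cell_one_two (hG : G.Connected) {θ c : ℝ} {σ : ℕ → ℝ}
    (hrec : ∀ u v, ∑ w ∈ sphere G 1 u, σ (G.dist w v) = θ * σ (G.dist u v)) {x y : V}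
    (hxy : G.dist x y = 1) (hx : defect G σ c x y x = 0) (hy : defect G σ c x y y = 0)
    (h : ∀ z ∈ cell G x y 1 2, defect G σ c x y z = 0) :
    ∑ z ∈ cell G x y 1 1, defect G σ c x y z = 0 := by
  -- The neighbours of `x` outside `D_1^1` are `y` and `D_1^2`, where the defect is zero.
  rw [Finset.sum_subset (s₂ := sphere G 1 x), sum_sphere_one_defect hrec, hx, mul_zero]
  · intro z hz
    exact mem_sphere.mpr (mem_cell.mp hz).1
  · intro z hz hz'
    rw [mem_sphere] at hz
    rw [mem_cell] at hz'
    have h1 := hG.dist_triangle (u := y) (v := x) (w := z)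
    rw [SimpleGraph.dist_comm (u := y) (v := x)] at h1
    have h2 : G.dist y z = 0 ∨ G.dist y z = 2 := by omega
    rcases h2 with h2 | h2
    · rw [← (hG.dist_eq_zero_iff.mp h2)]; exact hy
    · exact h z (mem_cell.mpr ⟨hz, h2⟩)

theorem defect_of_mem_cell {σ : ℕ → ℝ} {c : ℝ} {x y z : V} {i j : ℕ} (hz : z ∈ cell G x y i j) :
    defect G σ c x y z = ∑ w ∈ cell G x y 1 1, σ (G.dist z w) - c * (σ i + σ j) := by
  rw [mem_cell] at hz
  rw [defect, SimpleGraph.dist_comm (u := z) (v := x), SimpleGraph.dist_comm (u := z) (v := y),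
    hz.1, hz.2]

/-- For an edge `xy`, the cell `D_i^{i+1}` is nonempty when `i` is below the diameter. -/
theorem cell_succ_nonempty (hG : IsDistanceRegular G) {x y : V} (hxy : G.dist x y = 1) {i : ℕ}
    (hi : i + 1 ≤ G.diam) : (cell G x y i (i + 1)).Nonempty := by
  obtain ⟨u, w, v, huw, huv, hwv⟩ := exists_adj_dist_succ hG.1 hi
  -- Regularity transfers `p^1_{i,i+1} > 0` from the edge `wu` to `xy`.
  have h := hG.2 1 i (i + 1) (by omega) (by omega) hi w u x y
    (by rw [SimpleGraph.dist_comm, huw]) hxy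
  rw [cell, ← Finset.card_pos, ← h, Finset.card_pos]
  exact ⟨v, mem_cell.mpr ⟨hwv, huv⟩⟩

/-- If the two cosines agree, zero defect on `D_i^{i+1}` collapses to `a₁σ_i = 2cσ_i`, that is `(1 -
σ)σ_i = 0`. Both cosines then vanish, which the recurrence excludes. -/
theorem cosine_ne_succ_of_defect_eq_zero (hG : IsDistanceRegular G) {θ : ℝ} {σ : ℕ → ℝ}
    (h0 : σ 0 = 1)
    (hrec : ∀ u v, ∑ w ∈ sphere G 1 u, σ (G.dist w v) = θ * σ (G.dist u v))
    (hn : σ 1 ≠ -1) (h1 : σ 1 ≠ 1) {x y : V} (hxy : G.dist x y = 1)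
    (ha : ((cell G x y 1 1).card : ℝ) ≠ 0)
    (h : ∀ z, defect G σ ((cell G x y 1 1).card * σ 1 / (1 + σ 1)) x y z = 0) {i : ℕ}
    (hi : i + 1 ≤ G.diam) : σ i ≠ σ (i + 1) := by
  intro he
  obtain ⟨z, hz⟩ := cell_succ_nonempty hG hxy hi
  have hd := h z
  rw [defect_of_mem_cell hz, sum_dist_pair (by simp) (dist_cell_pair hG.1 hz), ← he, ← add_mul,
    ← card_dist_pair (by simp) (dist_cell_pair hG.1 hz)] at hd
  have hn' : 1 + σ 1 ≠ 0 := fun h => hn (by linarith)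
  have h1' : 1 - σ 1 ≠ 0 := fun h => h1 (by linarith)
  field_simp at hd
  have h2 : (1 - σ 1) * σ i = 0 := by
    apply mul_left_cancel₀ ha
    linarith
  have h3 : σ i = 0 := (mul_eq_zero.mp h2).resolve_left h1'
  exact not_consecutive_zero hG.1 h0 hrec i hi h3 (he ▸ h3)

end TightDRG

/-! ### The three characterisations -/

open TightDRG in
theorem theorem4p1 {V : Type*} [Fintype V] [DecidableEq V] (G : SimpleGraph V)
    (hG : TightDRG.IsDistanceRegular G) (d : ℕ) (hd : G.diam = d) (hd3 : 3 ≤ d)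
    (a₁ : ℕ) (ha₁ : TightDRG.intersectionA G 1 = a₁) (ha₁0 : a₁ ≠ 0)
    (θ : ℝ) (hθ : TightDRG.IsNontrivialEigenvalue G θ)
    (σ : ℕ → ℝ) (hσ : TightDRG.IsCosineSequence G θ σ)
    (x y : V) (hxy : G.Adj x y)
    (D : ℕ → ℕ → Finset V) (hD : D = TightDRG.cell G x y)
    (N : ℕ → V → ℝ)
    (hN : ∀ i z, N i z = ((TightDRG.sphere G i z ∩ D 1 1).card : ℝ)) :
    (TightDRG.IsTightEdge G θ x y ↔
      ∀ i : ℕ, 1 ≤ i → i ≤ d →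
        σ (i - 1) ≠ σ i ∧
        ∀ z ∈ D (i - 1) i,
          N (i - 1) z =
            a₁ / (1 + σ 1) * ((σ 1 * σ (i - 1) - σ i) / (σ (i - 1) - σ i)) ∧
          N i z =
            a₁ / (1 + σ 1) * ((σ (i - 1) - σ 1 * σ i) / (σ (i - 1) - σ i))) ∧
    (TightDRG.IsTightEdge G θ x y ↔
      ∀ i : ℕ, 1 ≤ i → i ≤ d - 1 →
        σ i ≠ σ (i + 1) ∧
        ∀ z ∈ D i i,
          N (i + 1) z =
            N (i - 1) z * ((σ (i - 1) - σ i) / (σ i - σ (i + 1))) +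
              a₁ * ((1 - σ 1) / (1 + σ 1)) * (σ i / (σ i - σ (i + 1))) ∧
          N i z =
            -(N (i - 1) z) * ((σ (i - 1) - σ (i + 1)) / (σ i - σ (i + 1))) +
              a₁ * (2 * σ 1 / (1 + σ 1)) -
              a₁ * ((1 - σ 1) / (1 + σ 1)) * (σ (i + 1) / (σ i - σ (i + 1)))) ∧
    (TightDRG.IsTightEdge G θ x y → TightDRG.intersectionA G d ≠ 0 →
      ∀ z ∈ D d d,
        N (d - 1) z =
          -(a₁ * ((1 - σ 1) / (1 + σ 1)) * (σ d / (σ (d - 1) - σ d))) ∧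
        N d z =
          a₁ + a₁ * ((1 - σ 1) / (1 + σ 1)) * (σ d / (σ (d - 1) - σ d))) := by
  subst hd hD
  have hdist : G.dist x y = 1 := SimpleGraph.dist_eq_one_iff_adj.mpr hxy
  have hcard : (cell G x y 1 1).card = a₁ := by
    rw [← ha₁]
    exact hG.card_inter_eq (by omega) (by omega) (by omega) hdist
  have ha : (a₁ : ℝ) ≠ 0 := Nat.cast_ne_zero.mpr ha₁0
  obtain ⟨E, hid, hE⟩ := hσ
  obtain ⟨κ, hκ, h0, hent⟩ := exists_entries_eq hG.1 hid hE
  have hrec := sum_sphere_one hid.2 hκ hent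
  have hs := transpose_of_mem_boseMesner hid.1.1
  have h1 : σ 1 ≠ 1 := by
    intro h1
    apply hθ.2
    -- At distance 0 the recurrence reads `kσ = θ`.
    have h := hrec x x
    rw [SimpleGraph.dist_self, h0, mul_one, Finset.sum_congr rfl (g := fun _ => (1 : ℝ)) (by
      intro w hw
      rw [SimpleGraph.dist_comm, mem_sphere.mp hw, h1])] at h
    rw [← h, valency, ← hG.card_inter_eq (x := x) (y := x) (by omega) (by omega) (by omega)
      SimpleGraph.dist_self]
    simp
  obtain ⟨t, ht⟩ : (cell G x y 1 1).Nonempty := by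
    rw [← Finset.card_pos]; omega
  have hn : σ 1 ≠ -1 := by
    rw [mem_cell] at ht
    exact cosine_one_ne_neg_one hs hid.1.2.2.1 hκ h0 hent hdist ht.1 ht.2
  have hn' : 1 + σ 1 ≠ 0 := fun h => hn (by linarith)
  have htight := isTightEdge_iff hid hκ h0 hn h1 hent hdist
  have hzero := defect_eq_zero_of_sum hs hid.1.2.2.1 hκ h0 hn hent hdist
  have hx := defect_left h0 hn hdist
  have hy := defect_right h0 hn hdist
  have hne := fun h (i : ℕ) (hi : i + 1 ≤ G.diam) =>
    cosine_ne_succ_of_defect_eq_zero hG h0 hrec hn h1 hdist (by rw [hcard]; exact ha) h hi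
  rw [hcard] at htight hzero hx hy hne
  rw [htight]
  refine ⟨⟨?_, ?_⟩, ⟨?_, ?_⟩, ?_⟩
  · intro h i hi hid'
    obtain ⟨j, rfl⟩ : ∃ j, i = j + 1 := ⟨i - 1, by omega⟩
    rw [Nat.add_sub_cancel]
    have hj := hne h j hid'
    refine ⟨hj, fun z hz => ?_⟩
    have hj' : σ j - σ (j + 1) ≠ 0 := sub_ne_zero.mpr hj
    have e1 := h z
    have e2 := card_dist_pair (by simp) (dist_cell_pair hG.1 hz)
    rw [defect_of_mem_cell hz, sum_dist_pair (by simp) (dist_cell_pair hG.1 hz)] at e1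
    rw [hcard] at e2
    rw [← hN, ← hN] at e1 e2
    field_simp at e1 ⊢
    -- Eliminating one count at a time from the 2×2 system with determinant `σ_j - σ_{j+1}`.
    constructor
    · linear_combination e1 + σ (j + 1) * (1 + σ 1) * e2
    · linear_combination -e1 - σ j * (1 + σ 1) * e2
  · intro h
    -- Only `i = 2`, the cell `D_1^2`, is needed.
    obtain ⟨hj, h⟩ := h 2 (by omega) (by omega)
    refine hzero (sum_defect_eq_zero_of_cell_one_two hG.1 hrec hdist hx hy fun z hz => ?_)
    obtain ⟨e1, e2⟩ := h z hz
    have hj' : σ 1 - σ 2 ≠ 0 := sub_ne_zero.mpr hj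
    rw [defect_of_mem_cell hz, sum_dist_pair (by simp) (dist_cell_pair hG.1 hz), ← hN, ← hN]
    norm_num only at e1 e2 ⊢
    rw [e1, e2]
    field_simp
    ring
  · intro h i hi hid'
    obtain ⟨j, rfl⟩ : ∃ j, i = j + 1 := ⟨i - 1, by omega⟩
    rw [Nat.add_sub_cancel]
    have hj := hne h (j + 1) (by omega)
    refine ⟨hj, fun z hz => ?_⟩
    have hj' : σ (j + 1) - σ (j + 1 + 1) ≠ 0 := sub_ne_zero.mpr hj
    have e1 := h z
    have e2 := card_dist_triple (dist_cell_triple hG.1 hz)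
    rw [defect_of_mem_cell hz, sum_dist_triple (dist_cell_triple hG.1 hz)] at e1
    rw [hcard] at e2
    rw [← hN, ← hN, ← hN] at e1 e2
    field_simp at e1 ⊢
    constructor
    · linear_combination -e1 - σ (j + 1) * (1 + σ 1) * e2
    · linear_combination e1 + σ (j + 1 + 1) * (1 + σ 1) * e2
  · intro h
    -- Only `i = 1` is needed: there the cell is `D_1^1` itself.
    obtain ⟨hj, h⟩ := h 1 le_rfl (by omega)
    refine hzero (Finset.sum_eq_zero fun z hz => ?_)
    obtain ⟨e1, e2⟩ := h z hz
    have hj' : σ 1 - σ 2 ≠ 0 := sub_ne_zero.mpr hj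
    have e3 : N 0 z + N 1 z + N 2 z = a₁ := by
      rw [hN, hN, hN, ← hcard]
      exact (card_dist_triple (dist_cell_triple hG.1 hz)).symm
    rw [defect_of_mem_cell hz, sum_dist_triple (dist_cell_triple hG.1 hz), ← hN, ← hN, ← hN]
    norm_num only at e1 e2 ⊢
    rw [e1, e2]
    rw [e1, e2] at e3
    field_simp
    ring
  · intro h _ z hz
    obtain ⟨j, hjd⟩ : ∃ j, G.diam = j + 1 := ⟨G.diam - 1, by omega⟩
    have hj := hne h j (by omega)
    have hj' : σ j - σ (j + 1) ≠ 0 := sub_ne_zero.mpr hj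
    rw [hjd] at hz ⊢
    rw [Nat.add_sub_cancel]
    -- Distance `d + 1` cannot occur, so the three-term count becomes a two-term one and both counts
    -- are determined.
    have hpair : ∀ w ∈ cell G x y 1 1, G.dist z w = j ∨ G.dist z w = j + 1 := by
      intro w hw
      have := dist_cell_triple hG.1 hz w hw
      have := dist_le_diam_of_connected hG.1 z w
      omega
    have e1 := h z
    have e2 := card_dist_pair (by simp) hpair
    rw [defect_of_mem_cell hz, sum_dist_pair (by simp) hpair] at e1
    rw [hcard] at e2
    rw [← hN, ← hN] at e1 e2
    field_simp at e1 ⊢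
    constructor
    · linear_combination e1 + σ (j + 1) * (1 + σ 1) * e2
    · linear_combination -e1 - σ j * (1 + σ 1) * e2
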